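/- **Setting.** Fix $\epsilon>0$, a characteristic velocity $\tilde v>0$, a positive integer $M$, a coarsest time step $\Delta t_0>0$ and an integer $N_0\ge 1$. Put $t^*=N_0\Delta t_0$ and, for $\ell\ge 0$, $\Delta t_\ell=\Delta t_0M^{-\ell}$ and $N_\ell=N_0M^\ell$, so that $\Delta t_{\ell-1}=M\Delta t_\ell$ and $t^*=N_\ell\Delta t_\ell$. For $\Delta t>0$ let $$p_{nc,\Delta t}=\frac{\epsilon^2}{\epsilon^2+\Delta t},\qquad D_{\Delta t}=\frac{\tilde v^2\Delta t}{\epsilon^2+\Delta t},\qquad \tilde v_{\Delta t}=\frac{\epsilon}{\epsilon^2+\Delta t}\,\tilde v .$$ Let $\mathcal B$ be a probability distribution on $\mathbb R$ with mean $0$ and variance $1$. **Fine trajectory (level $\ell\ge1$).** Let $\xi^k\sim\mathcal N(0,1)$, $u^k\sim\mathcal U([0,1])$, $\bar V^{k,*}\sim\mathcal B$ for $k=0,1,2,\dots$, let $(X^0,\bar V^0)$ be a random initial state whose law does not depend on $\ell$, with $\mathbb E[(\bar V^0)^2]<\infty$, and let all of these be mutually independent ($X^0$ and $\bar V^0$ may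 depend on each other). With $\Delta t=\Delta t_\ell$ put $$X^{k+1}=X^k+\Delta t\,V^k+\sqrt{2\Delta t}\sqrt{D_{\Delta t}}\;\xi^k,\qquad V^k=\tilde v_{\Delta t}\bar V^k,\qquad \bar V^{k+1}=\begin{cases}\bar V^{k,*}&\text{if }u^k\ge p_{nc,\Delta t},\\ \bar V^k&\text{otherwise.}\end{cases}$$ **Coupled coarse trajectory (level $\ell-1$).** It starts from the same $(X^0,\bar V^0)$ and follows the same recursion with $\Delta t=\Delta t_{\ell-1}$, where in its step $n$ the numbers $\xi^k$, $u^k$, $\bar V^{k,*}$ are replaced by $$\frac1{\sqrt M}\sum_{m=0}^{M-1}\xi^{nM+m},\qquad \Bigl(\max_{0\le m<M}u^{nM+m}\Bigr)^M,\qquad \bar V^{(n+1)M},$$ the last being the normalized velocity of the fine trajectory at the end of that coarse step. Let $F:\mathbb R\times\mathbb R\to\mathbb R$ satisfy $|F(x_1,v_1)-F(x_2,v_2)|\le K_x|x_1-x_2|+K_v|v_1-v_2|$ for all arguments. Let $\hat F_\ell$ be $F$ evaluated at the position and velocity of the fine trajectory after $N_\ell$ steps, and $\hat F_{\ell-1}$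 be $F$ evaluated at those of the coupled coarse trajectory after $N_{\ell-1}$ steps. **Lemma.** There exist an integer $L_2$ with $0<L_2<\infty$ and a constant $c_2>0$, both independent of $\ell$, such that for all $\ell\ge L_2$ the difference $\hat F_\ell-\hat F_{\ell-1}$ is square integrable and $$\mathbb V\bigl[\hat F_\ell-\hat F_{\ell-1}\bigr]\le c_2\,2^{-\beta\ell},\qquad \beta=\log_2 M .$$ -/

import Mathlib

open MeasureTheory ProbabilityTheory

namespace KineticMLMC

noncomputable section

/-- Probability that no collision takes place in a time step of size `dt`. -/
def pNoCollision (ε dt : ℝ) : ℝ := ε ^ 2 / (ε ^ 2 + dt)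

/-- Diffusion coefficient for the time step `dt`; `w` is the characteristic velocity of the
steady-state velocity distribution. -/
def diffusionCoeff (ε w dt : ℝ) : ℝ := w ^ 2 * dt / (ε ^ 2 + dt)

/-- Characteristic velocity of the velocity distribution for the time step `dt`. -/
def charVelocity (ε w dt : ℝ) : ℝ := ε / (ε ^ 2 + dt) * w

/-- Everything that determines one particle trajectory of the scheme: the initial position, the
initial normalized velocity and, for each time step `k`, the number `xi k` used in the
transport-diffusion step, the number `u k` that decides upon a collision, and the normalized
velocity `vstar k` that the particle takes if a collision occurs at the end of that step. -/
structure PathInput where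
  x0 : ℝ
  vbar0 : ℝ
  xi : ℕ → ℝ
  u : ℕ → ℝ
  vstar : ℕ → ℝ

namespace PathInput

/-- Normalized velocity after `k` steps: re-sampled in a collision, otherwise kept. -/
def vbar (I : PathInput) (ε dt : ℝ) : ℕ → ℝ
  | 0 => I.vbar0
  | k + 1 => if pNoCollision ε dt ≤ I.u k then I.vstar k else I.vbar ε dt k

/-- Velocity after `k` steps. -/
def vel (I : PathInput) (ε w dt : ℝ) (k : ℕ) : ℝ := charVelocity ε w dt * I.vbar ε dt k

/-- Position after `k` steps of size `dt`. -/
def pos (I : PathInput) (ε w dt : ℝ) : ℕ → ℝ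
  | 0 => I.x0
  | k + 1 => I.pos ε w dt k + dt * I.vel ε w dt k
      + √(2 * dt) * √(diffusionCoeff ε w dt) * I.xi k

/-- The input of the coarse simulation (one step for every `M` fine steps) computed from the input
of the fine simulation with time step `dt`. The `m`-th fine sub-step of the coarse step `n` is the
fine step `n * M + m`. In a coarse collision the coarse particle takes the last normalized velocity
generated by the fine particle, i.e. the one the fine particle has at the end of the coarse step. -/
def coarsen (I : PathInput) (ε dt : ℝ) (M : ℕ) : PathInput where
  x0 := I.x0
  vbar0 := I.vbar0
  xi n := (√(M : ℝ))⁻¹ * ∑ m : Fin M, I.xi (n * M + m)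
  u n := (⨆ m : Fin M, I.u (n * M + m)) ^ M
  vstar n := I.vbar ε dt ((n + 1) * M)

end PathInput

/-- The random input `I` of a fine simulation: the initial state has law `ν`, the `xi k` are standard
normal, the `u k` are uniform on `[0, 1]`, the `vstar k` have law `B`, and all of these are
mutually independent. -/
structure IsDrivingNoise {Ω : Type*} [MeasurableSpace Ω] (μ : Measure Ω) (B : Measure ℝ)
    (ν : Measure (ℝ × ℝ)) (I : Ω → PathInput) : Prop where
  measurable_init : Measurable fun ω => ((I ω).x0, (I ω).vbar0)
  measurable_xi : ∀ k, Measurable fun ω => (I ω).xi k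
  measurable_u : ∀ k, Measurable fun ω => (I ω).u k
  measurable_vstar : ∀ k, Measurable fun ω => (I ω).vstar k
  law_init : μ.map (fun ω => ((I ω).x0, (I ω).vbar0)) = ν
  law_xi : ∀ k, μ.map (fun ω => (I ω).xi k) = gaussianReal 0 1
  law_u : ∀ k, μ.map (fun ω => (I ω).u k) = volume.restrict (Set.Icc (0 : ℝ) 1)
  law_vstar : ∀ k, μ.map (fun ω => (I ω).vstar k) = B
  indep_steps : iIndepFun
    (fun (i : Fin 3 × ℕ) (ω : Ω) => (![(I ω).xi, (I ω).u, (I ω).vstar] i.1) i.2) μ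
  indep_init : IndepFun (fun ω => ((I ω).x0, (I ω).vbar0))
    (fun ω (k : ℕ) => ((I ω).xi k, (I ω).u k, (I ω).vstar k)) μ

/-- Time step at level `l`. -/
def timeStep (dt0 : ℝ) (M l : ℕ) : ℝ := dt0 / (M : ℝ) ^ l

/-- Number of time steps at level `l`, so that `numSteps N0 M l * timeStep dt0 M l` is the
level-independent end time `N0 * dt0`. -/
def numSteps (N0 M l : ℕ) : ℕ := N0 * M ^ l

/-- The approximation at level `l`: `F` at the end point of the trajectory with input `I`. -/
def levelValue (F : ℝ → ℝ → ℝ) (ε w dt0 : ℝ) (N0 M l : ℕ) (I : PathInput) : ℝ :=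
  F (I.pos ε w (timeStep dt0 M l) (numSteps N0 M l)) (I.vel ε w (timeStep dt0 M l) (numSteps N0 M l))

/-- The level difference for one pair of coupled trajectories, the fine one at level `l` with input
`I` and the coarse one at level `l - 1` with the input computed from `I` (used for `1 ≤ l`). -/
def levelDifference (F : ℝ → ℝ → ℝ) (ε w dt0 : ℝ) (N0 M l : ℕ) (I : PathInput) : ℝ :=
  levelValue F ε w dt0 N0 M l I
    - levelValue F ε w dt0 N0 M (l - 1) (I.coarsen ε (timeStep dt0 M l) M)

end

end KineticMLMC

-- Elementary estimates for collision thresholds and coefficients.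

namespace KineticMLMC

-- The coupled particles differ by O(√Δt) in mean square, and a Lipschitz F passes this on to the
-- variance, where Δt is proportional to M^{-ℓ} = 2^{-βℓ}. Velocities: every coarse collision copies
-- the fine velocity, so they can differ only if the fine particle collided in the current coarse
-- step, or collided earlier while the coarse one did not. The first has probability O(Δt). The
-- second confines some `u` to a window of length O(Δt²) (`le_add_of_pow_lt`), and there are O(1/Δt)
-- candidates. This bad event depends on the `u` alone, and given all `u` the normalized velocities
-- have bounded second moments (`CondSqLE`), so the mean square difference is O(Δt)
-- (`exists_vel_sub_le`); the change of characteristic velocity adds only O(Δt²). Positions: the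
-- drift difference is a time average of velocity differences, and the shared Gaussian sum has
-- variance O(1/Δt) with a coefficient mismatch of O(Δt) (`pos_sub_le`).

lemma exists_one_add_pow_le {a₀ : ℝ} (h₀ : 0 ≤ a₀) (M : ℕ) :
    ∃ C : ℝ, 0 ≤ C ∧ ∀ a : ℝ, 0 ≤ a → a ≤ a₀ → (1 + a) ^ M ≤ 1 + M * a + C * a ^ 2 := by
  induction M with
  | zero => exact ⟨0, le_rfl, fun a _ _ => by simp⟩
  | succ M ih =>
    obtain ⟨C, hC, h⟩ := ih
    -- Multiplying by `1 + a` gives the quadratic coefficient `M + C`; the cubic term is absorbed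
    -- using `a ≤ a₀`.
    refine ⟨M + C + C * a₀, by positivity, fun a ha ha₀ => ?_⟩
    have h1 : (1 + a) ^ (M + 1) ≤ (1 + M * a + C * a ^ 2) * (1 + a) := by
      rw [pow_succ]
      exact mul_le_mul_of_nonneg_right (h a ha ha₀) (by linarith)
    have h2 : C * a ^ 2 * a ≤ C * a ^ 2 * a₀ := mul_le_mul_of_nonneg_left ha₀ (by positivity)
    push_cast
    nlinarith

/-- With u = (1+s)/(1+a), Bernoulli gives (1+Ms)(1+Ma) < (1+a)^M. The linear terms `M * a` cancel,
leaving s ≤ Ca². This is the window for a fine collision missed by the coarse particle. -/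
lemma le_add_of_pow_lt {a C u : ℝ} {M : ℕ} (hM : 0 < M) (ha : 0 ≤ a)
    (h : (1 + a) ^ M ≤ 1 + M * a + C * a ^ 2) (hu : (1 + a)⁻¹ ≤ u)
    (huM : u ^ M < (1 + M * a)⁻¹) : u ≤ (1 + a)⁻¹ + C * a ^ 2 := by
  have ha1 : 0 < 1 + a := by linarith
  have hM1 : (1 : ℝ) ≤ M := by exact_mod_cast hM
  have hMa : 0 < 1 + M * a := by positivity
  set s := (1 + a) * u - 1 with hs
  have hs0 : 0 ≤ s := by
    have := (inv_le_iff_one_le_mul₀' ha1).1 hu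
    linarith
  have hbern : 1 + M * s ≤ (1 + s) ^ M := one_add_mul_le_pow (by linarith) M
  have hpow : (1 + s) ^ M * (1 + M * a) < (1 + a) ^ M := by
    have : 1 + s = (1 + a) * u := by rw [hs]; ring
    rw [this, mul_pow, mul_assoc]
    have := mul_lt_mul_of_pos_right huM hMa
    rw [inv_mul_cancel₀ hMa.ne'] at this
    nlinarith [pow_pos ha1 M]
  have hsC : s ≤ C * a ^ 2 := by
    have h1 : (1 + M * s) * (1 + M * a) ≤ (1 + s) ^ M * (1 + M * a) :=
      mul_le_mul_of_nonneg_right hbern hMa.le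
    have h2 : s ≤ M * s := le_mul_of_one_le_left hs0 hM1
    have h3 : 0 ≤ (M * s) * (M * a) := by positivity
    nlinarith
  have hu' : u = (1 + a)⁻¹ + (1 + a)⁻¹ * s := by rw [hs]; field_simp; ring
  have hinv : (1 + a)⁻¹ ≤ 1 := inv_le_one_of_one_le₀ (by linarith)
  have : (1 + a)⁻¹ * s ≤ s := mul_le_of_le_one_left hs0 hinv
  linarith

lemma pNoCollision_eq {ε : ℝ} (hε : 0 < ε) (dt : ℝ) :
    pNoCollision ε dt = (1 + dt / ε ^ 2)⁻¹ := by
  unfold pNoCollision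
  have : 1 + dt / ε ^ 2 = (ε ^ 2 + dt) / ε ^ 2 := by field_simp
  rw [this, inv_div]

lemma one_sub_pNoCollision_le {ε dt : ℝ} (hε : 0 < ε) (hdt : 0 ≤ dt) :
    1 - pNoCollision ε dt ≤ dt / ε ^ 2 := by
  have h1 : 0 < ε ^ 2 := by positivity
  unfold pNoCollision
  rw [one_sub_div (by positivity), add_sub_cancel_left]
  gcongr
  linarith

lemma charVelocity_nonneg {ε w dt : ℝ} (hε : 0 < ε) (hw : 0 < w) (hdt : 0 ≤ dt) :
    0 ≤ charVelocity ε w dt := by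
  unfold charVelocity; positivity

lemma charVelocity_le {ε w dt : ℝ} (hε : 0 < ε) (hw : 0 < w) (hdt : 0 ≤ dt) :
    charVelocity ε w dt ≤ w / ε := by
  unfold charVelocity
  rw [div_mul_eq_mul_div, div_le_div_iff₀ (by positivity) hε]
  nlinarith [mul_nonneg hw.le hdt]

lemma abs_charVelocity_sub_le {ε w dt dt' : ℝ} (hε : 0 < ε) (hw : 0 < w) (hdt : 0 ≤ dt)
    (h : dt ≤ dt') :
    |charVelocity ε w dt - charVelocity ε w dt'| ≤ w * dt' / ε ^ 3 := by
  have hdt' : 0 ≤ dt' := hdt.trans h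
  have hε2 : 0 < ε ^ 2 := by positivity
  have e : charVelocity ε w dt - charVelocity ε w dt'
      = ε * w * (dt' - dt) / ((ε ^ 2 + dt) * (ε ^ 2 + dt')) := by
    unfold charVelocity
    field_simp
    ring
  have h0 : 0 ≤ dt' - dt := by linarith
  rw [e, abs_of_nonneg (by positivity)]
  calc ε * w * (dt' - dt) / ((ε ^ 2 + dt) * (ε ^ 2 + dt'))
      ≤ ε * w * dt' / (ε ^ 2 * ε ^ 2) := by gcongr <;> linarith
    _ = w * dt' / ε ^ 3 := by field_simp

lemma diffusionCoeff_le {ε w dt : ℝ} (hε : 0 < ε) (hdt : 0 ≤ dt) :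
    diffusionCoeff ε w dt ≤ w ^ 2 * dt / ε ^ 2 := by
  have h1 : 0 < ε ^ 2 := by positivity
  unfold diffusionCoeff
  gcongr
  linarith

lemma diffusionCoeff_nonneg {ε w dt : ℝ} (hdt : 0 ≤ dt) : 0 ≤ diffusionCoeff ε w dt := by
  unfold diffusionCoeff; positivity

/-- Mismatch of the noise coefficients of the fine and the coarse scheme. -/
lemma sq_noiseCoeff_sub_le {ε w dt : ℝ} {M : ℕ} (hε : 0 < ε) (hM : 0 < M) (hdt : 0 ≤ dt) :
    (√(2 * dt) * √(diffusionCoeff ε w dt)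
      - √(2 * (M * dt)) * √(diffusionCoeff ε w (M * dt)) * (√(M : ℝ))⁻¹) ^ 2
      ≤ 4 * (1 + M) * w ^ 2 / ε ^ 2 * dt ^ 2 := by
  have hM' : (0 : ℝ) < M := by exact_mod_cast hM
  have hMdt : 0 ≤ M * dt := by positivity
  have hs : √(2 * (M * dt)) = √(M : ℝ) * √(2 * dt) := by
    rw [← Real.sqrt_mul hM'.le]; congr 1; ring
  have hsM : √(M : ℝ) ≠ 0 := (Real.sqrt_pos.2 hM').ne'
  have e : √(2 * (M * dt)) * √(diffusionCoeff ε w (M * dt)) * (√(M : ℝ))⁻¹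
      = √(2 * dt) * √(diffusionCoeff ε w (M * dt)) := by
    rw [hs]; field_simp
  rw [e, ← mul_sub, mul_pow, Real.sq_sqrt (by positivity)]
  have h1 := Real.sq_sqrt (diffusionCoeff_nonneg (ε := ε) (w := w) hdt)
  have h2 := Real.sq_sqrt (diffusionCoeff_nonneg (ε := ε) (w := w) hMdt)
  have h3 := diffusionCoeff_le (w := w) hε hdt
  have h4 := diffusionCoeff_le (w := w) hε hMdt
  set x := √(diffusionCoeff ε w dt)
  set y := √(diffusionCoeff ε w (M * dt))
  -- No cancellation between the roots is needed: each diffusion coefficient is itself O(dt).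
  have h5 : (x - y) ^ 2 ≤ 2 * (w ^ 2 * dt / ε ^ 2 + w ^ 2 * (M * dt) / ε ^ 2) := by
    nlinarith [sq_nonneg (x + y)]
  calc 2 * dt * (x - y) ^ 2
      ≤ 2 * dt * (2 * (w ^ 2 * dt / ε ^ 2 + w ^ 2 * (M * dt) / ε ^ 2)) := by gcongr
    _ = _ := by ring

-- Pathwise comparison of the coupled trajectories.

lemma sum_range_mul_eq (f : ℕ → ℝ) (n M : ℕ) :
    ∑ j ∈ Finset.range (n * M), f j = ∑ i ∈ Finset.range n, ∑ m : Fin M, f (i * M + m) := by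
  induction n with
  | zero => simp
  | succ n ih =>
    rw [Nat.succ_mul, Finset.sum_range_add, ih, Finset.sum_range_succ, Finset.sum_range (n := M)]

lemma sum_range_mul_div (f : ℕ → ℝ) (n : ℕ) {M : ℕ} (hM : 0 < M) :
    ∑ j ∈ Finset.range (n * M), f (j / M) = M * ∑ i ∈ Finset.range n, f i := by
  rw [sum_range_mul_eq (fun j => f (j / M)), Finset.mul_sum]
  refine Finset.sum_congr rfl fun i _ => ?_
  have : ∀ m : Fin M, (i * M + m) / M = i := fun m => by
    rw [mul_comm, Nat.mul_add_div hM, Nat.div_eq_of_lt m.2, add_zero]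
  simp [this]

namespace PathInput

lemma pos_eq (I : PathInput) (ε w dt : ℝ) (k : ℕ) :
    I.pos ε w dt k = I.x0 + dt * ∑ j ∈ Finset.range k, I.vel ε w dt j
      + √(2 * dt) * √(diffusionCoeff ε w dt) * ∑ j ∈ Finset.range k, I.xi j := by
  induction k with
  | zero => simp [pos]
  | succ k ih => rw [pos, ih, Finset.sum_range_succ, Finset.sum_range_succ]; ring

/-- Both positions carry the same sum of the `xi`, so the noise enters only through its coefficient
mismatch; `j / M` is the coarse step containing fine step `j`. -/
lemma pos_sub_pos_coarsen (I : PathInput) (ε w dt : ℝ) {M : ℕ} (hM : 0 < M) (n : ℕ) :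
    I.pos ε w dt (n * M) - (I.coarsen ε dt M).pos ε w (M * dt) n
      = dt * ∑ j ∈ Finset.range (n * M),
          (I.vel ε w dt j - (I.coarsen ε dt M).vel ε w (M * dt) (j / M))
        + (√(2 * dt) * √(diffusionCoeff ε w dt)
            - √(2 * (M * dt)) * √(diffusionCoeff ε w (M * dt)) * (√(M : ℝ))⁻¹)
          * ∑ j ∈ Finset.range (n * M), I.xi j := by
  have hxi : ∑ i ∈ Finset.range n, (I.coarsen ε dt M).xi i
      = (√(M : ℝ))⁻¹ * ∑ j ∈ Finset.range (n * M), I.xi j := by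
    rw [sum_range_mul_eq, Finset.mul_sum]; rfl
  rw [pos_eq, pos_eq, hxi, Finset.sum_sub_distrib,
    sum_range_mul_div (fun i => (I.coarsen ε dt M).vel ε w (M * dt) i) n hM]
  change I.x0 + _ + _ - (I.x0 + _ + _) = _
  ring

lemma vbar_add_eq (I : PathInput) {ε dt : ℝ} {k m : ℕ}
    (h : ∀ i < m, I.u (k + i) < pNoCollision ε dt) : I.vbar ε dt (k + m) = I.vbar ε dt k := by
  induction m with
  | zero => rfl
  | succ m ih =>
    rw [← add_assoc, vbar, if_neg (not_le.2 (h m m.lt_succ_self)),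
      ih fun i hi => h i (hi.trans m.lt_succ_self)]

/-- Fine and coarse normalized velocities agree as long as every collision of the fine particle
comes with a collision of the coarse particle. -/
lemma vbar_coarsen_eq (I : PathInput) {ε dt dt' : ℝ} {M : ℕ} (hε : 0 < ε) (hdt : 0 ≤ dt) {n : ℕ}
    (h : ∀ i < n, ∀ m < M, pNoCollision ε dt ≤ I.u (i * M + m) →
      pNoCollision ε dt' ≤ I.u (i * M + m) ^ M) :
    (I.coarsen ε dt M).vbar ε dt' n = I.vbar ε dt (n * M) := by
  induction n with
  | zero => rw [zero_mul]; rfl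
  | succ n ih =>
    rw [vbar]
    -- A coarse collision restores agreement whatever happened before. Without one, the hypothesis
    -- rules out fine collisions in this step.
    split_ifs with hc
    · rfl
    · rw [ih fun i hi => h i (hi.trans n.lt_succ_self), Nat.succ_mul, vbar_add_eq]
      intro m hm
      by_contra! hu
      refine hc ((h n n.lt_succ_self m hm hu).trans ?_)
      -- The `u` are not bounded pointwise; the nonnegativity needed to take `M`-th powers comes
      -- from the threshold.
      have hp : 0 ≤ pNoCollision ε dt := by unfold pNoCollision; positivity
      exact pow_le_pow_left₀ (hp.trans hu)
        (le_ciSup (f := fun m : Fin M => I.u (n * M + m)) (Set.finite_range _).bddAbove ⟨m, hm⟩) M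

end PathInput

end KineticMLMC

-- The mismatch event and second moments conditional on the collisions.

namespace KineticMLMC

variable {Ω : Type*}

/-- The σ-algebra generated by the numbers that decide upon collisions. -/
abbrev collisionSigma (I : Ω → PathInput) : MeasurableSpace Ω :=
  ⨆ k, MeasurableSpace.comap (fun ω => (I ω).u k) inferInstance

lemma measurable_u_collisionSigma (I : Ω → PathInput) (k : ℕ) :
    Measurable[collisionSigma I] fun ω => (I ω).u k :=
  (comap_measurable _).mono
    (le_iSup (fun k => MeasurableSpace.comap (fun ω => (I ω).u k) inferInstance) k) le_rfl

/-- The collisions for which fine and coarse normalized velocity at fine step `j` of the coarse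
step `n` may differ. -/
def mismatch (I : Ω → PathInput) (ε dt dt' : ℝ) (M n : ℕ) : Set Ω :=
  (⋃ i ∈ Finset.range n, ⋃ m ∈ Finset.range M,
    {ω | pNoCollision ε dt ≤ (I ω).u (i * M + m) ∧
      (I ω).u (i * M + m) ^ M < pNoCollision ε dt'}) ∪
  ⋃ m ∈ Finset.range M, {ω | pNoCollision ε dt ≤ (I ω).u (n * M + m)}

lemma measurableSet_mismatch (I : Ω → PathInput) (ε dt dt' : ℝ) (M n : ℕ) :
    MeasurableSet[collisionSigma I] (mismatch I ε dt dt' M n) := by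
  have hu := measurable_u_collisionSigma I
  let _ : MeasurableSpace Ω := collisionSigma I
  refine .union (Finset.measurableSet_biUnion _ fun i _ => Finset.measurableSet_biUnion _
    fun m _ => ?_) (Finset.measurableSet_biUnion _ fun m _ => ?_)
  · exact (measurableSet_le measurable_const (hu _)).inter
      (measurableSet_lt ((hu _).pow_const M) measurable_const)
  · exact measurableSet_le measurable_const (hu _)

/-- Off the first part of the event the velocities agree at the start of the current coarse step;
off the second the fine one has not changed since. -/
lemma vbar_eq_of_notMem_mismatch {I : Ω → PathInput} {ε dt dt' : ℝ} {M : ℕ} (hε : 0 < ε)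
    (hM : 0 < M) (hdt : 0 ≤ dt) {j : ℕ} {ω : Ω} (h : ω ∉ mismatch I ε dt dt' M (j / M)) :
    (I ω).vbar ε dt j = ((I ω).coarsen ε dt M).vbar ε dt' (j / M) := by
  simp only [mismatch, Set.mem_union, Set.mem_iUnion, Finset.mem_range, Set.mem_ofPred_eq,
    exists_prop, not_or, not_exists, not_and, not_lt, not_le] at h
  rw [PathInput.vbar_coarsen_eq _ hε hdt h.1]
  conv_lhs => rw [← Nat.div_add_mod' j M]
  exact PathInput.vbar_add_eq _ fun i hi => h.2 i (hi.trans (Nat.mod_lt j hM))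

variable [m0 : MeasurableSpace Ω] {μ : Measure Ω}

/-- Square integrable functions whose conditional second moment given `m` is at most `C`. -/
structure CondSqLE {Ω : Type*} (m : MeasurableSpace Ω) {m0 : MeasurableSpace Ω} (μ : Measure Ω) (C : ℝ) (Y : Ω → ℝ) : Prop where
  memLp : MemLp Y 2 μ
  setIntegral_le : ∀ A, MeasurableSet[m] A → ∫ ω in A, Y ω ^ 2 ∂μ ≤ C * μ.real A

namespace CondSqLE

lemma of_indep [IsProbabilityMeasure μ] {m m' : MeasurableSpace Ω} (hm : m ≤ m0) (hm' : m' ≤ m0)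
    {C : ℝ} {Y : Ω → ℝ} (hY : Measurable[m'] Y) (hL : MemLp Y 2 μ) (hC : ∫ ω, Y ω ^ 2 ∂μ ≤ C)
    (hind : Indep m' m μ) : CondSqLE m μ C Y := by
  refine ⟨hL, fun A hA => ?_⟩
  have h1 := condExp_indep_eq hm' hm (f := fun ω => Y ω ^ 2)
    (Measurable.stronglyMeasurable (hY.pow_const 2)) hind
  rw [← setIntegral_condExp hm hL.integrable_sq hA, integral_congr_ae (ae_restrict_of_ae h1),
    setIntegral_const, smul_eq_mul, mul_comm]
  exact mul_le_mul_of_nonneg_right hC measureReal_nonneg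

/-- The constant does not grow because the selection is `m`-measurable: each test set splits into
two that are again in `m`. Hence the bound survives any number of collisions. -/
lemma ite [IsFiniteMeasure μ] {m : MeasurableSpace Ω} (hm : m ≤ m0) {C : ℝ} {Y Z : Ω → ℝ}
    (hY : CondSqLE m μ C Y) (hZ : CondSqLE m μ C Z) {p : Ω → Prop} [DecidablePred p]
    (hp : MeasurableSet[m] {ω | p ω}) : CondSqLE m μ C fun ω => if p ω then Y ω else Z ω := by
  have hL : MemLp (fun ω => if p ω then Y ω else Z ω) 2 μ :=
    MemLp.piecewise (s := {ω | p ω}) (hm _ hp) (hY.memLp.restrict _) (hZ.memLp.restrict _)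
  refine ⟨hL, fun A hA => ?_⟩
  have h1 : MeasurableSet[m0] (A ∩ {ω | p ω}) := hm _ (hA.inter hp)
  have h2 : MeasurableSet[m0] (A \ {ω | p ω}) := hm _ (hA.diff hp)
  rw [← integral_inter_add_sdiff (hm _ hp) hL.integrable_sq.integrableOn,
    ← measureReal_inter_add_sdiff (s := A) (hm _ hp), mul_add]
  refine add_le_add ?_ ?_
  · rw [setIntegral_congr_fun (g := fun ω => Y ω ^ 2) h1 fun ω hω => ?_]
    · exact hY.setIntegral_le _ (hA.inter hp)
    · have : p ω := hω.2
      simp [this]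
  · rw [setIntegral_congr_fun (g := fun ω => Z ω ^ 2) h2 fun ω hω => ?_]
    · exact hZ.setIntegral_le _ (hA.diff hp)
    · have : ¬ p ω := hω.2
      simp [this]

/-- The conditional bound is what yields the factor `μ.real A`: plain second moments would give no
decay with the probability of `A`. -/
lemma integral_sub_sq_le {m : MeasurableSpace Ω} {C : ℝ}
    {Y Z : Ω → ℝ} (hY : CondSqLE m μ C Y) (hZ : CondSqLE m μ C Z) {A : Set Ω}
    (hA : MeasurableSet[m] A) (h : ∀ ω ∉ A, Y ω = Z ω) :
    ∫ ω, (Y ω - Z ω) ^ 2 ∂μ ≤ 4 * C * μ.real A := by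
  have h1 : ∫ ω, (Y ω - Z ω) ^ 2 ∂μ = ∫ ω in A, (Y ω - Z ω) ^ 2 ∂μ :=
    (setIntegral_eq_integral_of_forall_compl_eq_zero fun ω hω => by simp [h ω hω]).symm
  have iY := hY.memLp.integrable_sq.integrableOn (s := A)
  have iZ := hZ.memLp.integrable_sq.integrableOn (s := A)
  have h2 : ∫ ω in A, (Y ω - Z ω) ^ 2 ∂μ ≤ ∫ ω in A, (2 * Y ω ^ 2 + 2 * Z ω ^ 2) ∂μ :=
    integral_mono (hY.memLp.sub hZ.memLp).integrable_sq.integrableOn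
      ((iY.const_mul 2).add (iZ.const_mul 2)) fun ω => by
        dsimp only; nlinarith [sq_nonneg (Y ω + Z ω)]
  rw [integral_add (iY.const_mul 2) (iZ.const_mul 2), integral_const_mul, integral_const_mul] at h2
  linarith [hY.setIntegral_le A hA, hZ.setIntegral_le A hA]

end CondSqLE

lemma measurable_vbar {I : Ω → PathInput} (h0 : Measurable fun ω => (I ω).vbar0)
    (hu : ∀ k, Measurable fun ω => (I ω).u k) (hv : ∀ k, Measurable fun ω => (I ω).vstar k)
    (ε dt : ℝ) (k : ℕ) : Measurable fun ω => (I ω).vbar ε dt k := by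
  induction k with
  | zero => exact h0
  | succ k ih => exact Measurable.ite (measurableSet_le measurable_const (hu k)) (hv k) ih

lemma measurable_pos {I : Ω → PathInput} (hx : Measurable fun ω => (I ω).x0)
    (h0 : Measurable fun ω => (I ω).vbar0) (hxi : ∀ k, Measurable fun ω => (I ω).xi k)
    (hu : ∀ k, Measurable fun ω => (I ω).u k) (hv : ∀ k, Measurable fun ω => (I ω).vstar k)
    (ε w dt : ℝ) (k : ℕ) : Measurable fun ω => (I ω).pos ε w dt k := by
  induction k with
  | zero => exact hx
  | succ k ih =>
    exact (ih.add (((measurable_vbar h0 hu hv ε dt k).const_mul _).const_mul _)).add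
      ((hxi k).const_mul _)

-- Probabilistic estimates for the driving noise.

namespace IsDrivingNoise

variable {B : Measure ℝ} {ν : Measure (ℝ × ℝ)} {I : Ω → PathInput}

lemma collisionSigma_le (h : IsDrivingNoise μ B ν I) : collisionSigma I ≤ m0 :=
  iSup_le fun k => (h.measurable_u k).comap_le

lemma measure_u_mem_le [IsProbabilityMeasure μ] (h : IsDrivingNoise μ B ν I) (k : ℕ) {a b : ℝ}
    (hab : a ≤ b) {S : Set Ω} (hS : ∀ ω ∈ S, (I ω).u k ∈ Set.Icc (0 : ℝ) 1 → (I ω).u k ∈ Set.Icc a b) :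
    μ.real S ≤ b - a := by
  have hae : ∀ᵐ ω ∂μ, (I ω).u k ∈ Set.Icc (0 : ℝ) 1 := by
    have := ae_restrict_mem (μ := (volume : Measure ℝ)) (measurableSet_Icc (a := (0 : ℝ)) (b := 1))
    rw [← h.law_u k] at this
    exact ae_of_ae_map (h.measurable_u k).aemeasurable this
  have h1 : μ S ≤ μ ((fun ω => (I ω).u k) ⁻¹' Set.Icc a b) :=
    measure_mono_ae (hae.mono fun ω hω hS' => hS ω hS' hω)
  rw [← Measure.map_apply (h.measurable_u k) measurableSet_Icc, h.law_u k] at h1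
  have h2 := h1.trans (Measure.restrict_apply_le _ _)
  rw [Real.volume_Icc] at h2
  exact ENNReal.toReal_le_of_le_ofReal (by linarith) h2

/-- Union bound: `n * M` possible missed collisions, each confined to the quadratic window, plus `M`
possible collisions in the current coarse step. -/
lemma measure_mismatch_le [IsProbabilityMeasure μ] (h : IsDrivingNoise μ B ν I) {ε dt C : ℝ}
    (hε : 0 < ε) (hdt : 0 ≤ dt) {M : ℕ} (hM : 0 < M) (hC : 0 ≤ C)
    (hpow : (1 + dt / ε ^ 2) ^ M ≤ 1 + M * (dt / ε ^ 2) + C * (dt / ε ^ 2) ^ 2) (n : ℕ) :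
    μ.real (mismatch I ε dt (M * dt) M n) ≤ n * M * (C * (dt / ε ^ 2) ^ 2) + M * (dt / ε ^ 2) := by
  have ha : 0 ≤ dt / ε ^ 2 := by positivity
  have hp' : pNoCollision ε (M * dt) = (1 + M * (dt / ε ^ 2))⁻¹ := by
    rw [pNoCollision_eq hε, mul_div_assoc]
  refine (measureReal_union_le _ _).trans (add_le_add ?_ ?_)
  · refine (measureReal_biUnion_finset_le _ _).trans ?_
    have : ∀ i ∈ Finset.range n, μ.real (⋃ m ∈ Finset.range M,
        {ω | pNoCollision ε dt ≤ (I ω).u (i * M + m) ∧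
          (I ω).u (i * M + m) ^ M < pNoCollision ε (M * dt)}) ≤ M * (C * (dt / ε ^ 2) ^ 2) := by
      intro i _
      refine (measureReal_biUnion_finset_le _ _).trans ?_
      refine (Finset.sum_le_card_nsmul _ _ (C * (dt / ε ^ 2) ^ 2) fun m _ => ?_).trans_eq
        (by simp)
      refine (h.measure_u_mem_le (i * M + m)
        (a := pNoCollision ε dt) (b := pNoCollision ε dt + C * (dt / ε ^ 2) ^ 2)
        (by nlinarith [mul_nonneg hC (sq_nonneg (dt / ε ^ 2))]) ?_).trans_eq (by ring)
      rintro ω ⟨h1, h2⟩ -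
      refine ⟨h1, ?_⟩
      rw [hp'] at h2
      rw [pNoCollision_eq hε] at h1 ⊢
      exact le_add_of_pow_lt hM ha hpow h1 h2
    exact (Finset.sum_le_card_nsmul _ _ _ this).trans_eq (by simp [mul_assoc])
  · refine (measureReal_biUnion_finset_le _ _).trans ?_
    refine (Finset.sum_le_card_nsmul _ _ (dt / ε ^ 2) fun m _ => ?_).trans_eq (by simp)
    have hp1 : pNoCollision ε dt ≤ 1 := by
      rw [pNoCollision_eq hε]; exact inv_le_one_of_one_le₀ (by linarith)
    exact (h.measure_u_mem_le (n * M + m) hp1 fun ω hω hu => ⟨hω, hu.2⟩).trans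
      (one_sub_pNoCollision_le hε hdt)

lemma condSqLE_vstar [IsProbabilityMeasure μ] (h : IsDrivingNoise μ B ν I)
    (hB : MemLp id 2 B) {C : ℝ} (hC : ∫ v, v ^ 2 ∂B ≤ C) (k : ℕ) :
    CondSqLE (collisionSigma I) μ C fun ω => (I ω).vstar k := by
  have hmeas : ∀ i : Fin 3 × ℕ, Measurable
      (fun ω => (![(I ω).xi, (I ω).u, (I ω).vstar] i.1) i.2) := by
    rintro ⟨i, k⟩
    fin_cases i
    exacts [h.measurable_xi k, h.measurable_u k, h.measurable_vstar k]
  have hind : Indep (MeasurableSpace.comap (fun ω => (I ω).vstar k) inferInstance)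
      (collisionSigma I) μ := by
    -- Index 2 selects `vstar`, index 1 selects `u`; disjoint index sets generate independent
    -- σ-algebras.
    have hd : Disjoint ({((2 : Fin 3), k)} : Set (Fin 3 × ℕ)) {i | i.1 = 1} := by
      rw [Set.disjoint_singleton_left]
      simp
    have := indep_iSup_of_disjoint (fun i => (hmeas i).comap_le) h.indep_steps hd
    refine indep_of_indep_of_le_left (indep_of_indep_of_le_right this ?_) ?_
    · exact iSup_le fun j => le_iSup₂_of_le ((1 : Fin 3), j) rfl le_rfl
    · exact le_iSup₂_of_le ((2 : Fin 3), k) rfl le_rfl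
  refine .of_indep h.collisionSigma_le (h.measurable_vstar k).comap_le (comap_measurable _) ?_ ?_
    hind
  · have hB' : MemLp id 2 (μ.map fun ω => (I ω).vstar k) := by rwa [h.law_vstar k]
    exact hB'.comp_of_map (h.measurable_vstar k).aemeasurable
  · rw [← h.law_vstar k, integral_map (h.measurable_vstar k).aemeasurable
      (by fun_prop)] at hC
    exact hC

lemma condSqLE_vbar0 [IsProbabilityMeasure μ] (h : IsDrivingNoise μ B ν I)
    (hν : MemLp (fun z : ℝ × ℝ => z.2) 2 ν) {C : ℝ} (hC : ∫ z : ℝ × ℝ, z.2 ^ 2 ∂ν ≤ C) :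
    CondSqLE (collisionSigma I) μ C fun ω => (I ω).vbar0 := by
  have hind : Indep (MeasurableSpace.comap (fun ω => ((I ω).x0, (I ω).vbar0)) inferInstance)
      (collisionSigma I) μ := by
    refine indep_of_indep_of_le_right h.indep_init (iSup_le fun k => ?_)
    rw [← measurable_iff_comap_le]
    exact (measurable_fst.comp (measurable_snd.comp (measurable_pi_apply k))).comp
      (comap_measurable fun ω (k : ℕ) => ((I ω).xi k, (I ω).u k, (I ω).vstar k))
  refine .of_indep h.collisionSigma_le h.measurable_init.comap_le
    (measurable_snd.comp (comap_measurable fun ω => ((I ω).x0, (I ω).vbar0))) ?_ ?_ hind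
  · rw [← h.law_init] at hν
    exact hν.comp_of_map h.measurable_init.aemeasurable
  · rw [← h.law_init, integral_map h.measurable_init.aemeasurable (by fun_prop)] at hC
    exact hC

lemma condSqLE_vbar [IsProbabilityMeasure μ] (h : IsDrivingNoise μ B ν I)
    (hB : MemLp id 2 B) (hν : MemLp (fun z : ℝ × ℝ => z.2) 2 ν) {C : ℝ}
    (hBC : ∫ v, v ^ 2 ∂B ≤ C) (hνC : ∫ z : ℝ × ℝ, z.2 ^ 2 ∂ν ≤ C) (ε dt : ℝ) (k : ℕ) :
    CondSqLE (collisionSigma I) μ C fun ω => (I ω).vbar ε dt k := by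
  induction k with
  | zero => exact h.condSqLE_vbar0 hν hνC
  | succ k ih =>
    refine (h.condSqLE_vstar hB hBC k).ite h.collisionSigma_le ih ?_
    have := measurable_u_collisionSigma I k
    let _ : MeasurableSpace Ω := collisionSigma I
    exact measurableSet_le measurable_const this

/-- Coarse collisions are also decided by the `u` alone, and the velocity copied is a fine one, so
the same `C` works. -/
lemma condSqLE_vbar_coarsen [IsProbabilityMeasure μ] (h : IsDrivingNoise μ B ν I)
    (hB : MemLp id 2 B) (hν : MemLp (fun z : ℝ × ℝ => z.2) 2 ν) {C : ℝ}
    (hBC : ∫ v, v ^ 2 ∂B ≤ C) (hνC : ∫ z : ℝ × ℝ, z.2 ^ 2 ∂ν ≤ C) (ε dt dt' : ℝ) (M n : ℕ) :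
    CondSqLE (collisionSigma I) μ C fun ω => ((I ω).coarsen ε dt M).vbar ε dt' n := by
  induction n with
  | zero => exact h.condSqLE_vbar0 hν hνC
  | succ n ih =>
    refine (h.condSqLE_vbar hB hν hBC hνC ε dt ((n + 1) * M)).ite h.collisionSigma_le ih ?_
    have := fun m => measurable_u_collisionSigma I m
    let _ : MeasurableSpace Ω := collisionSigma I
    exact measurableSet_le measurable_const
      ((Measurable.iSup fun m : Fin M => this (n * M + m)).pow_const M)

lemma memLp_xi (h : IsDrivingNoise μ B ν I) (k : ℕ) : MemLp (fun ω => (I ω).xi k) 2 μ := by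
  have := memLp_id_gaussianReal (μ := 0) (v := 1) 2
  rw [← h.law_xi k] at this
  exact this.comp_of_map (h.measurable_xi k).aemeasurable

lemma integral_sum_xi_sq [IsProbabilityMeasure μ] (h : IsDrivingNoise μ B ν I) (K : ℕ) :
    ∫ ω, (∑ j ∈ Finset.range K, (I ω).xi j) ^ 2 ∂μ = K := by
  have hlaw : ∀ k, HasLaw (fun ω => (I ω).xi k) (gaussianReal 0 1) μ := fun k =>
    ⟨(h.measurable_xi k).aemeasurable, h.law_xi k⟩
  have hE : ∀ k, ∫ ω, (I ω).xi k ∂μ = 0 := fun k => by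
    rw [(hlaw k).integral_eq, integral_id_gaussianReal]
  have hV : ∀ k, Var[fun ω => (I ω).xi k; μ] = 1 := fun k => by
    rw [(hlaw k).variance_eq, variance_id_gaussianReal]; rfl
  have hsum : ∫ ω, (∑ j ∈ Finset.range K, fun ω => (I ω).xi j) ω ∂μ = 0 := by
    simp only [Finset.sum_apply]
    rw [integral_finsetSum _ fun j _ => (h.memLp_xi j).integrable one_le_two]
    simp [hE]
  have hvar : Var[∑ j ∈ Finset.range K, fun ω => (I ω).xi j; μ] = K := by
    rw [IndepFun.variance_sum (fun j _ => h.memLp_xi j) fun i _ j _ hij => ?_]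
    · simp [hV]
    · exact h.indep_steps.indepFun (i := ((0 : Fin 3), i)) (j := ((0 : Fin 3), j)) (by simpa using hij)
  rw [variance_of_integral_eq_zero (Finset.aemeasurable_sum _ fun j _ =>
    (h.measurable_xi j).aemeasurable) hsum] at hvar
  simpa using hvar

end IsDrivingNoise

end KineticMLMC

-- Mean square differences and the Lipschitz functional.

namespace KineticMLMC

/-- Split px − qy = p(x − y) + (p − q)y. -/
lemma vel_sub_sq_le {ε w dt dt' x y : ℝ} (hε : 0 < ε) (hw : 0 < w) (hdt : 0 ≤ dt)
    (h : dt ≤ dt') :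
    (charVelocity ε w dt * x - charVelocity ε w dt' * y) ^ 2
      ≤ 2 * (w / ε) ^ 2 * (x - y) ^ 2 + 2 * (w * dt' / ε ^ 3) ^ 2 * y ^ 2 := by
  have h1 : charVelocity ε w dt ^ 2 ≤ (w / ε) ^ 2 :=
    pow_le_pow_left₀ (charVelocity_nonneg hε hw hdt) (charVelocity_le hε hw hdt) 2
  have h2 : (charVelocity ε w dt - charVelocity ε w dt') ^ 2 ≤ (w * dt' / ε ^ 3) ^ 2 := by
    rw [← sq_abs]
    exact pow_le_pow_left₀ (abs_nonneg _) (abs_charVelocity_sub_le hε hw hdt h) 2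
  have h3 := mul_le_mul_of_nonneg_right h1 (sq_nonneg (x - y))
  have h4 := mul_le_mul_of_nonneg_right h2 (sq_nonneg y)
  set p := charVelocity ε w dt
  set q := charVelocity ε w dt'
  have h5 : (p * x - q * y) ^ 2 ≤ 2 * (p ^ 2 * (x - y) ^ 2) + 2 * ((p - q) ^ 2 * y ^ 2) := by
    nlinarith [sq_nonneg (p * (x - y) - (p - q) * y)]
  linarith

variable {Ω : Type*} [m0 : MeasurableSpace Ω] {μ : Measure Ω}

namespace IsDrivingNoise

variable {B : Measure ℝ} {ν : Measure (ℝ × ℝ)} {I : Ω → PathInput}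

/-- The mean square difference of the coupled velocities is of the order of the time step. -/
lemma exists_vel_sub_le {ε w dt₀ T : ℝ} (hε : 0 < ε) (hw : 0 < w) (hdt₀ : 0 < dt₀) (hT : 0 < T)
    {M : ℕ} (hM : 0 < M) (B : Measure ℝ) (hB : MemLp id 2 B)
    (ν : Measure (ℝ × ℝ)) (hν : MemLp (fun z : ℝ × ℝ => z.2) 2 ν) :
    ∃ K : ℝ, 0 ≤ K ∧ ∀ dt : ℝ, 0 < dt → dt ≤ dt₀ → ∀ n : ℕ, n * M * dt ≤ T →
      ∀ (Ω : Type*) [MeasurableSpace Ω] (μ : Measure Ω) [IsProbabilityMeasure μ]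
        (I : Ω → PathInput), IsDrivingNoise μ B ν I → ∀ j ≤ n * M,
        MemLp (fun ω => (I ω).vel ε w dt j
          - ((I ω).coarsen ε dt M).vel ε w (M * dt) (j / M)) 2 μ ∧
        ∫ ω, ((I ω).vel ε w dt j
          - ((I ω).coarsen ε dt M).vel ε w (M * dt) (j / M)) ^ 2 ∂μ ≤ K * dt := by
  obtain ⟨C, hC, hpow⟩ := exists_one_add_pow_le (a₀ := dt₀ / ε ^ 2) (by positivity) M
  set S : ℝ := ∫ v, v ^ 2 ∂B + ∫ z : ℝ × ℝ, z.2 ^ 2 ∂ν with hS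
  have hS1 : 0 ≤ ∫ v, v ^ 2 ∂B := integral_nonneg fun _ => sq_nonneg _
  have hS2 : 0 ≤ ∫ z : ℝ × ℝ, z.2 ^ 2 ∂ν := integral_nonneg fun _ => sq_nonneg _
  have hS0 : 0 ≤ S := add_nonneg hS1 hS2
  -- `K₁ * dt` bounds the mismatch probability; `T` replaces `n * M * dt`, so the constant is
  -- independent of the level.
  set K₁ : ℝ := (T * C / ε ^ 2 + M) / ε ^ 2 with hK₁
  have hK₁0 : 0 ≤ K₁ := by positivity
  refine ⟨2 * (w / ε) ^ 2 * (4 * S * K₁) + 2 * (w * M / ε ^ 3) ^ 2 * dt₀ * S, by positivity, ?_⟩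
  intro dt hdt hdt' n hn Ω _ μ _ I h j hj
  have hM1 : (1 : ℝ) ≤ M := by exact_mod_cast hM
  have hX := h.condSqLE_vbar hB hν (C := S) (by linarith) (by linarith) ε dt j
  have hY := h.condSqLE_vbar_coarsen hB hν (C := S) (by linarith) (by linarith)
    ε dt (M * dt) M (j / M)
  have hA : μ.real (mismatch I ε dt (M * dt) M (j / M)) ≤ K₁ * dt := by
    refine (h.measure_mismatch_le hε hdt.le hM hC
      (hpow _ (by positivity) (by gcongr)) (j / M)).trans ?_
    have h1 : ((j / M : ℕ) : ℝ) ≤ n := by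
      exact_mod_cast Nat.div_le_of_le_mul (by rwa [mul_comm] at hj)
    calc ((j / M : ℕ) : ℝ) * M * (C * (dt / ε ^ 2) ^ 2) + M * (dt / ε ^ 2)
        ≤ n * M * (C * (dt / ε ^ 2) ^ 2) + M * (dt / ε ^ 2) := by gcongr
      _ = (n * M * dt) * (C * dt / ε ^ 4) + M * (dt / ε ^ 2) := by field_simp
      _ ≤ T * (C * dt / ε ^ 4) + M * (dt / ε ^ 2) := by gcongr
      _ = K₁ * dt := by rw [hK₁]; field_simp
  have hXY : ∫ ω, ((I ω).vbar ε dt j - ((I ω).coarsen ε dt M).vbar ε (M * dt) (j / M)) ^ 2 ∂μ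
      ≤ 4 * S * (K₁ * dt) :=
    (hX.integral_sub_sq_le hY (measurableSet_mismatch I ε dt (M * dt) M (j / M)) fun ω hω =>
      vbar_eq_of_notMem_mismatch hε hM hdt.le hω).trans (by gcongr)
  have hY2 : ∫ ω, ((I ω).coarsen ε dt M).vbar ε (M * dt) (j / M) ^ 2 ∂μ ≤ S := by
    simpa using hY.setIntegral_le Set.univ (@MeasurableSet.univ _ (collisionSigma I))
  have hL := (hX.memLp.const_mul (charVelocity ε w dt)).sub
    (hY.memLp.const_mul (charVelocity ε w (M * dt)))
  refine ⟨hL, ?_⟩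
  have i1 := ((hX.memLp.sub hY.memLp).integrable_sq).const_mul (2 * (w / ε) ^ 2)
  have i2 := hY.memLp.integrable_sq.const_mul (2 * (w * (M * dt) / ε ^ 3) ^ 2)
  simp only [Pi.sub_apply] at i1
  have key := integral_mono hL.integrable_sq (i1.add i2) fun ω =>
    vel_sub_sq_le (x := (I ω).vbar ε dt j) (y := ((I ω).coarsen ε dt M).vbar ε (M * dt) (j / M))
      hε hw hdt.le (le_mul_of_one_le_left hdt.le hM1)
  refine key.trans ?_
  simp only [Pi.add_apply]
  rw [integral_add i1 i2, integral_const_mul, integral_const_mul]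
  calc _ ≤ 2 * (w / ε) ^ 2 * (4 * S * (K₁ * dt)) + 2 * (w * (M * dt) / ε ^ 3) ^ 2 * S := by gcongr
    _ = 2 * (w / ε) ^ 2 * (4 * S * K₁) * dt + 2 * (w * M / ε ^ 3) ^ 2 * dt * S * dt := by ring
    _ ≤ 2 * (w / ε) ^ 2 * (4 * S * K₁) * dt + 2 * (w * M / ε ^ 3) ^ 2 * dt₀ * S * dt := by gcongr
    _ = _ := by ring

/-- The mean square difference of the coupled positions is of the order of the time step. -/
lemma pos_sub_le [IsProbabilityMeasure μ] (h : IsDrivingNoise μ B ν I) {ε w dt T K : ℝ}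
    (hε : 0 < ε) (hdt : 0 < dt) {M : ℕ} (hM : 0 < M) {n : ℕ} (hn : n * M * dt = T)
    (hL : ∀ j ≤ n * M, MemLp (fun ω => (I ω).vel ε w dt j
          - ((I ω).coarsen ε dt M).vel ε w (M * dt) (j / M)) 2 μ)
    (hK : ∀ j ≤ n * M, ∫ ω, ((I ω).vel ε w dt j
          - ((I ω).coarsen ε dt M).vel ε w (M * dt) (j / M)) ^ 2 ∂μ ≤ K * dt) :
    MemLp (fun ω => (I ω).pos ε w dt (n * M) - ((I ω).coarsen ε dt M).pos ε w (M * dt) n) 2 μ ∧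
    ∫ ω, ((I ω).pos ε w dt (n * M) - ((I ω).coarsen ε dt M).pos ε w (M * dt) n) ^ 2 ∂μ
      ≤ (2 * T ^ 2 * K + 8 * (1 + M) * w ^ 2 / ε ^ 2 * T) * dt := by
  simp_rw [PathInput.pos_sub_pos_coarsen _ ε w dt hM n]
  set s := √(2 * dt) * √(diffusionCoeff ε w dt)
    - √(2 * (M * dt)) * √(diffusionCoeff ε w (M * dt)) * (√(M : ℝ))⁻¹ with hs
  have hs2 : s ^ 2 ≤ 4 * (1 + M) * w ^ 2 / ε ^ 2 * dt ^ 2 := sq_noiseCoeff_sub_le hε hM hdt.le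
  set f : ℕ → Ω → ℝ := fun j ω => (I ω).vel ε w dt j
    - ((I ω).coarsen ε dt M).vel ε w (M * dt) (j / M) with hf
  have hL' : ∀ j ∈ Finset.range (n * M), MemLp (f j) 2 μ :=
    fun j hj => hL j (Finset.mem_range.1 hj).le
  have hsum : MemLp (fun ω => ∑ j ∈ Finset.range (n * M), f j ω) 2 μ := memLp_finsetSum _ hL'
  have hxi : MemLp (fun ω => ∑ j ∈ Finset.range (n * M), (I ω).xi j) 2 μ :=
    memLp_finsetSum _ fun j _ => h.memLp_xi j
  have hmem := (hsum.const_mul dt).add (hxi.const_mul s)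
  refine ⟨hmem, ?_⟩
  have hfi : ∀ j ∈ Finset.range (n * M), Integrable (fun ω => f j ω ^ 2) μ :=
    fun j hj => (hL' j hj).integrable_sq
  have i1 := (integrable_finsetSum _ hfi).const_mul (2 * dt ^ 2 * (n * M))
  have i2 := hxi.integrable_sq.const_mul (2 * s ^ 2)
  have key := integral_mono hmem.integrable_sq (i1.add i2) fun ω => by
    -- Cauchy–Schwarz costs a factor `n * M` and the sum has `n * M` terms; `dt ^ 2` turns both into
    -- `T ^ 2`.
    have cs := sq_sum_le_card_mul_sum_sq (s := Finset.range (n * M)) (f := fun j => f j ω)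
    rw [Finset.card_range] at cs
    push_cast at cs
    simp only [Pi.add_apply]
    set x := ∑ j ∈ Finset.range (n * M), f j ω
    set y := ∑ j ∈ Finset.range (n * M), (I ω).xi j
    have h1 := mul_le_mul_of_nonneg_left cs (by positivity : 0 ≤ 2 * dt ^ 2)
    have h2 : (dt * x + s * y) ^ 2 ≤ 2 * dt ^ 2 * x ^ 2 + 2 * s ^ 2 * y ^ 2 := by
      nlinarith [sq_nonneg (dt * x - s * y)]
    show (dt * x + s * y) ^ 2 ≤ _
    linarith
  refine key.trans ?_
  simp only [Pi.add_apply]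
  rw [integral_add i1 i2, integral_const_mul, integral_const_mul, integral_finsetSum _ hfi,
    h.integral_sum_xi_sq]
  have hsumle : ∑ j ∈ Finset.range (n * M), ∫ ω, f j ω ^ 2 ∂μ ≤ n * M * (K * dt) := by
    refine (Finset.sum_le_card_nsmul _ _ (K * dt) fun j hj =>
      hK j (Finset.mem_range.1 hj).le).trans_eq ?_
    rw [Finset.card_range, nsmul_eq_mul]
    push_cast
    rfl
  push_cast
  calc _ ≤ 2 * dt ^ 2 * (n * M) * (n * M * (K * dt))
        + 2 * (4 * (1 + M) * w ^ 2 / ε ^ 2 * dt ^ 2) * (n * M) := by gcongr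
    _ = _ := by rw [← hn]; ring

end IsDrivingNoise

/-- Needed for the joint measurability of `F`. -/
lemma continuous_of_abs_sub_le {F : ℝ → ℝ → ℝ} {Kx Kv : ℝ}
    (hF : ∀ x₁ x₂ v₁ v₂ : ℝ, |F x₁ v₁ - F x₂ v₂| ≤ Kx * |x₁ - x₂| + Kv * |v₁ - v₂|) :
    Continuous fun z : ℝ × ℝ => F z.1 z.2 := by
  refine continuous_iff_continuousAt.2 fun z => tendsto_iff_dist_tendsto_zero.2 ?_
  have hg : Continuous fun y : ℝ × ℝ => Kx * |y.1 - z.1| + Kv * |y.2 - z.2| := by fun_prop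
  have := hg.tendsto z
  simp only [sub_self, abs_zero, mul_zero, add_zero] at this
  exact squeeze_zero (fun _ => dist_nonneg) (fun y => hF _ _ _ _) this

/-- A Lipschitz function of two coupled pairs has a difference whose variance is controlled by
the mean square differences of the components. -/
lemma memLp_and_variance_le_of_abs_sub_le [IsProbabilityMeasure μ] {F : ℝ → ℝ → ℝ} {Kx Kv : ℝ}
    (hF : ∀ x₁ x₂ v₁ v₂ : ℝ, |F x₁ v₁ - F x₂ v₂| ≤ Kx * |x₁ - x₂| + Kv * |v₁ - v₂|)
    {X X' V V' : Ω → ℝ} (hX : Measurable X) (hX' : Measurable X') (hV : Measurable V)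
    (hV' : Measurable V') (hXX : MemLp (fun ω => X ω - X' ω) 2 μ)
    (hVV : MemLp (fun ω => V ω - V' ω) 2 μ) :
    MemLp (fun ω => F (X ω) (V ω) - F (X' ω) (V' ω)) 2 μ ∧
    Var[fun ω => F (X ω) (V ω) - F (X' ω) (V' ω); μ]
      ≤ 2 * Kx ^ 2 * ∫ ω, (X ω - X' ω) ^ 2 ∂μ + 2 * Kv ^ 2 * ∫ ω, (V ω - V' ω) ^ 2 ∂μ := by
  have hFm := (continuous_of_abs_sub_le hF).measurable
  have hm : Measurable fun ω => F (X ω) (V ω) - F (X' ω) (V' ω) :=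
    (hFm.comp (hX.prodMk hV)).sub (hFm.comp (hX'.prodMk hV'))
  have hL : MemLp (fun ω => F (X ω) (V ω) - F (X' ω) (V' ω)) 2 μ :=
    ((hXX.abs.const_mul Kx).add (hVV.abs.const_mul Kv)).mono' hm.aestronglyMeasurable
      (.of_forall fun ω => hF _ _ _ _)
  refine ⟨hL, (variance_le_expectation_sq hm.aestronglyMeasurable).trans ?_⟩
  have i1 := hXX.integrable_sq.const_mul (2 * Kx ^ 2)
  have i2 := hVV.integrable_sq.const_mul (2 * Kv ^ 2)
  rw [← integral_const_mul, ← integral_const_mul, ← integral_add i1 i2]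
  refine integral_mono hL.integrable_sq (i1.add i2) fun ω => ?_
  have h1 := pow_le_pow_left₀ (abs_nonneg _) (hF (X ω) (X' ω) (V ω) (V' ω)) 2
  rw [sq_abs] at h1
  refine h1.trans ?_
  rw [← sq_abs (X ω - X' ω), ← sq_abs (V ω - V' ω)]
  nlinarith [sq_nonneg (Kx * |X ω - X' ω| - Kv * |V ω - V' ω|)]

lemma two_rpow_neg_logb_mul {M : ℕ} (hM : 0 < M) (l : ℕ) :
    (2 : ℝ) ^ (-(Real.logb 2 M) * (l : ℝ)) = ((M : ℝ) ^ l)⁻¹ := by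
  rw [neg_mul, Real.rpow_neg zero_le_two, Real.rpow_mul zero_le_two,
    Real.rpow_logb two_pos (by norm_num) (by exact_mod_cast hM), Real.rpow_natCast]

end KineticMLMC

-- Assembly at level `l`.

theorem lemma9
    -- mean free path, characteristic velocity, coarsest time step, number of coarsest steps,
    -- refinement factor
    (ε w dt0 : ℝ) (hε : 0 < ε) (hw : 0 < w) (hdt0 : 0 < dt0)
    (N0 M : ℕ) (hN0 : 0 < N0) (hM : 0 < M)
    -- the normalized velocity distribution
    (B : Measure ℝ) [IsProbabilityMeasure B] (hB : MemLp id 2 B)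
    (hB_mean : ∫ v, v ∂B = 0) (hB_var : Var[id; B] = 1)
    -- the law of the initial position and initial normalized velocity
    (ν : Measure (ℝ × ℝ)) [IsProbabilityMeasure ν] (hν : MemLp (fun z : ℝ × ℝ => z.2) 2 ν)
    -- the quantity of interest
    (F : ℝ → ℝ → ℝ) (Kx Kv : ℝ)
    (hF : ∀ x₁ x₂ v₁ v₂ : ℝ, |F x₁ v₁ - F x₂ v₂| ≤ Kx * |x₁ - x₂| + Kv * |v₁ - v₂|) :
    ∃ L₂ : ℕ, 0 < L₂ ∧ ∃ c₂ : ℝ, 0 < c₂ ∧ ∀ l : ℕ, L₂ ≤ l →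
      ∀ (Ω : Type*) [MeasurableSpace Ω] (μ : Measure Ω) [IsProbabilityMeasure μ]
        (I : Ω → KineticMLMC.PathInput), KineticMLMC.IsDrivingNoise μ B ν I →
        MemLp (fun ω => KineticMLMC.levelDifference F ε w dt0 N0 M l (I ω)) 2 μ ∧
        Var[fun ω => KineticMLMC.levelDifference F ε w dt0 N0 M l (I ω); μ]
          ≤ c₂ * (2 : ℝ) ^ (-(Real.logb 2 M) * (l : ℝ)) := by
  open KineticMLMC in
  have hM' : (0 : ℝ) < M := by exact_mod_cast hM
  have hM1 : (1 : ℝ) ≤ M := by exact_mod_cast hM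
  have hN0' : (0 : ℝ) < N0 := by exact_mod_cast hN0
  obtain ⟨K, hK, hvel⟩ := IsDrivingNoise.exists_vel_sub_le (T := N0 * dt0) hε hw hdt0
    (by positivity) hM B hB ν hν
  set K' : ℝ := 2 * (N0 * dt0) ^ 2 * K + 8 * (1 + M) * w ^ 2 / ε ^ 2 * (N0 * dt0) with hK'
  have hK'0 : 0 ≤ K' := by positivity
  -- The estimates hold for every `dt ≤ dt0`, so level 1 suffices. The summand 1 keeps the constant
  -- positive when `Kx` and `Kv` vanish.
  refine ⟨1, one_pos, (2 * Kx ^ 2 * K' + 2 * Kv ^ 2 * K + 1) * dt0, by positivity, ?_⟩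
  intro l hl Ω _ μ _ I h
  obtain ⟨k, rfl⟩ : ∃ k, l = k + 1 := ⟨l - 1, by omega⟩
  set dt := timeStep dt0 M (k + 1) with hdt_def
  have hdt : 0 < dt := by rw [hdt_def, timeStep]; positivity
  have hdt_le : dt ≤ dt0 := div_le_self hdt0.le (one_le_pow₀ hM1)
  have hcoarse : timeStep dt0 M k = M * dt := by
    rw [hdt_def, timeStep, timeStep, pow_succ]; field_simp
  set n := N0 * M ^ k with hn
  have hfine : numSteps N0 M (k + 1) = n * M := by rw [numSteps, hn, pow_succ, mul_assoc]
  have hT : (n : ℝ) * M * dt = N0 * dt0 := by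
    rw [hn, hdt_def, timeStep, pow_succ]; push_cast; field_simp
  have hv := hvel dt hdt hdt_le n hT.le Ω μ I h
  have hp := h.pos_sub_le hε hdt hM hT (fun j hj => (hv j hj).1) fun j hj => (hv j hj).2
  -- The velocity estimate includes the endpoint `j = n * M`, where `j / M = n` gives the terminal
  -- velocities.
  have hv' := hv (n * M) le_rfl
  rw [Nat.mul_div_cancel _ hM] at hv'
  have hx := measurable_fst.comp h.measurable_init
  have hv0 := measurable_snd.comp h.measurable_init
  have hvc : ∀ j, Measurable fun ω => ((I ω).coarsen ε dt M).vstar j := fun j =>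
    measurable_vbar hv0 h.measurable_u h.measurable_vstar ε dt ((j + 1) * M)
  have huc : ∀ j, Measurable fun ω => ((I ω).coarsen ε dt M).u j := fun j =>
    (Measurable.iSup fun m : Fin M => h.measurable_u (j * M + m)).pow_const M
  have hxic : ∀ j, Measurable fun ω => ((I ω).coarsen ε dt M).xi j := fun j =>
    (Finset.measurable_sum _ fun (m : Fin M) _ => h.measurable_xi (j * M + m)).const_mul _
  obtain ⟨hL, hVar⟩ := memLp_and_variance_le_of_abs_sub_le hF
    (measurable_pos hx hv0 h.measurable_xi h.measurable_u h.measurable_vstar ε w dt (n * M))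
    (measurable_pos (I := fun ω => (I ω).coarsen ε dt M) hx hv0 hxic huc hvc ε w (M * dt) n)
    ((measurable_vbar hv0 h.measurable_u h.measurable_vstar ε dt (n * M)).const_mul _)
    ((measurable_vbar (I := fun ω => (I ω).coarsen ε dt M) hv0 huc hvc ε (M * dt) n).const_mul _)
    hp.1 hv'.1
  have hdiff : (fun ω => levelDifference F ε w dt0 N0 M (k + 1) (I ω))
      = fun ω => F ((I ω).pos ε w dt (n * M)) ((I ω).vel ε w dt (n * M))
        - F (((I ω).coarsen ε dt M).pos ε w (M * dt) n)
          (((I ω).coarsen ε dt M).vel ε w (M * dt) n) := by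
    funext ω
    rw [levelDifference, levelValue, levelValue, Nat.add_sub_cancel, hcoarse, hfine]
    rfl
  rw [hdiff, two_rpow_neg_logb_mul hM]
  refine ⟨hL, hVar.trans ?_⟩
  calc _ ≤ 2 * Kx ^ 2 * (K' * dt) + 2 * Kv ^ 2 * (K * dt) :=
        add_le_add (mul_le_mul_of_nonneg_left hp.2 (by positivity))
          (mul_le_mul_of_nonneg_left hv'.2 (by positivity))
    _ ≤ (2 * Kx ^ 2 * K' + 2 * Kv ^ 2 * K + 1) * dt := by linarith
    _ = (2 * Kx ^ 2 * K' + 2 * Kv ^ 2 * K + 1) * dt0 * ((M : ℝ) ^ (k + 1))⁻¹ := by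
      rw [hdt_def, timeStep]; ring
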